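/- Setting. A matching market under distributional constraints $(S,C,X,\succ_S,\succ_C,f)$ consists of finite sets $S$ of students and $C=\{c_1,\dots,c_m\}$ of colleges, a set $X\subseteq S\times C$ of contracts, for each $s\in S$ a strict total order $\succ_s$ on $X_s\cup\{(s,\emptyset)\}$, for each $c\in C$ a strict total order $\succ_c$ on $X_c\cup\{(\emptyset,c)\}$ with $(s,c)\succ_c(\emptyset,c)$ for all $(s,c)\in X$, and a function $f:\mathbb{Z}_{\ge 0}^m\to\{-\infty,0\}$. Here $Y_s$ and $Y_c$ are the sets of contracts in $Y\subseteq X$ of $s$ and of $c$. Write $\nu(Y)=(|Y_{c_1}|,\dots,|Y_{c_m}|)$ and let $|\nu|$ be the sum of the entries of $\nu$. A vector $\nu$ is feasible in $f$ if $f(\nu)=0$, and $Y$ is feasible in $f$ if $\nu(Y)$ is. The vectors feasible in $f$ form the set $F$ induced by $f$. Assume that $f$ is hereditary: $0\in F$, and $\nu\in F$, $\nu'\le\nu$ imply $\nu'\in F$. A set $F\subseteq\mathbb{Z}_{\ge 0}^m$ is M$^\natural$-convex if for all $\nu,\nu'\in F$ and all $i$ with $\nu_i>\nu'_i$ there is $j\in\{0\}\cup\{k:\nu_k<\nu'_k\}$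 with $\nu-e_i+e_j\in F$ and $\nu'+e_i-e_j\in F$, where $e_0=0$ and $e_1,\dots,e_m$ are the unit vectors. A contract $(s,c)\in X$ is acceptable (for $s$) if $(s,c)\succ_s(s,\emptyset)$. A set $Y\subseteq X$ is a matching if, for each $s$, either $Y_s=\emptyset$ or $Y_s$ consists of one acceptable contract. In a matching $Y$, student $s$ strongly claims an empty seat of $c$ if $(s,c)\in X$ is acceptable, $(s,c)\succ_s Y_s$ (i.e. $(s,c)$ is preferred to the contract in $Y_s$, or $Y_s=\emptyset$), and $Y\cup\{(s,c)\}$ is feasible in $f$. A matching is weakly nonwasteful if no student strongly claims an empty seat of any college. Mechanism. Let $w:X\to\mathbb{R}_{>0}$ be injective with $w(s,c)>w(s',c)$ whenever $(s,c)\succ_c(s',c)$, and put $w(Y)=\sum_{x\in Y}w(x)$. For $Y\subseteq X$ let $Ch_S(Y)$ consist, for each student $s$ with an acceptable contract in $Y_s$, of the most preferred such contract, and for $g:\mathbb{Z}_{\ge 0}^m\to\{-\infty,0\}$ let $Ch_C(Y)=\arg\max_{Y'\subseteq Y}\,(g(\nu(Y'))+w(Y'))$. GDA based on $g$ on a set $X'$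 of contracts starts with $Re=\emptyset$ and repeats: let $Y=Ch_S(X'\setminus Re)$ and $Z=Ch_C(Y)$; if $Z=Y$, return $Y$; otherwise add $Y\setminus Z$ to $Re$. MS-GDA takes a master list $L$, in which each student occurs exactly once, and starts with $Y=\emptyset$. As long as $L$ is nonempty it performs a stage. With $f_k(\nu)=f(\nu+\nu(Y))$, and $f_k^d(\nu)=f_k(\nu)$ if $|\nu|\le d$ and $f_k^d(\nu)=-\infty$ otherwise, it chooses any integer $d\ge 1$ such that $f_k^d$ induces an M$^\natural$-convex set, removes the top $d$ students from $L$ (all of them, if fewer than $d$ remain), applies GDA based on $f_k^d$ to the contracts of the removed students, and adds the result to $Y$. When $L$ is empty it returns $Y$. Theorem. If $f$ is hereditary, then MS-GDA obtains a weakly nonwasteful matching: for every such $w$ and $L$ it can be carried out to the end, and for all admissible choices of the numbers $d$ the set $Y$ that it returns is a matching in which no student strongly claims an empty seat. -/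

import Mathlib

namespace DistMatching

/-- `r` is a strict total order on the set `A`; nothing is said about `r` outside `A`. -/
def IsStrictTotalOrderOn {α : Type*} (A : Set α) (r : α → α → Prop) : Prop :=
  (∀ a ∈ A, ¬ r a a) ∧
  (∀ a ∈ A, ∀ b ∈ A, ∀ c ∈ A, r a b → r b c → r a c) ∧
  (∀ a ∈ A, ∀ b ∈ A, r a b ∨ a = b ∨ r b a)

/-- The set of vectors that a `{-∞, 0}`-valued function `f` allows. -/
def induced {C : Type*} (f : (C → ℕ) → EReal) : Set (C → ℕ) := {ν | f ν = 0}

/-- Hereditary families of vectors: they contain `0` and are closed under going down. -/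
def Hereditary {C : Type*} (F : Set (C → ℕ)) : Prop :=
  0 ∈ F ∧ ∀ ν ν' : C → ℕ, ν' < ν → ν ∈ F → ν' ∈ F

/-- M-natural-convex sets of nonnegative integer vectors. `Pi.single i 1` is the `i`-th unit vector;
the first alternative is the exchange with the zero vector. All the subtractions are genuine, since
`ν' i < ν i` and `ν j < ν' j`. -/
def MNaturalConvex {C : Type*} [DecidableEq C] (F : Set (C → ℕ)) : Prop :=
  ∀ ν ∈ F, ∀ ν' ∈ F, ∀ i : C, ν' i < ν i →
    (ν - Pi.single i 1 ∈ F ∧ ν' + Pi.single i 1 ∈ F) ∨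
    ∃ j : C, ν j < ν' j ∧
      ν - Pi.single i 1 + Pi.single j 1 ∈ F ∧ ν' + Pi.single i 1 - Pi.single j 1 ∈ F

/-- A matching market under distributional constraints, with students `S` and colleges `C`.
The outcome `none` of a student (college) is the outcome of being unmatched. -/
structure Market (S C : Type*) where
  /-- the available contracts -/
  X : Finset (S × C)
  /-- `prefS s o o'`: student `s` strictly prefers `o` to `o'` -/
  prefS : S → Option C → Option C → Prop
  /-- `prefC c o o'`: college `c` strictly prefers `o` to `o'` -/
  prefC : C → Option S → Option S → Prop
  /-- the distributional constraints -/
  f : (C → ℕ) → EReal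
  prefS_strict : ∀ s, IsStrictTotalOrderOn {o | ∀ c, o = some c → (s, c) ∈ X} (prefS s)
  prefC_strict : ∀ c, IsStrictTotalOrderOn {o | ∀ s, o = some s → (s, c) ∈ X} (prefC c)
  acceptable_college : ∀ s c, (s, c) ∈ X → prefC c (some s) none
  f_range : ∀ ν, f ν = ⊥ ∨ f ν = 0

/-- The vector `ν(Y)` of the numbers of contracts in `Y` of each college. -/
def vec {S C : Type*} [DecidableEq C] (Y : Finset (S × C)) : C → ℕ :=
  fun c => (Y.filter (fun x => x.2 = c)).card

/-- `Y_s`, the contracts in `Y` of student `s`. -/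
def contractsOf {S C : Type*} [DecidableEq S] (Y : Finset (S × C)) (s : S) : Finset (S × C) :=
  Y.filter (fun x => x.1 = s)

/-- `Y` is feasible in `f`. -/
def Feasible {S C : Type*} [DecidableEq C] (f : (C → ℕ) → EReal) (Y : Finset (S × C)) : Prop :=
  f (vec Y) = 0

/-- The contract `x` is acceptable for its student. -/
def Market.Acceptable {S C : Type*} (M : Market S C) (x : S × C) : Prop :=
  M.prefS x.1 (some x.2) none

/-- `Y` is a matching: each student has at most one contract, and it is acceptable for her. -/
def Market.IsMatching {S C : Type*} [DecidableEq S] (M : Market S C) (Y : Finset (S × C)) : Prop :=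
  Y ⊆ M.X ∧ ∀ s, (∃ x, contractsOf Y s = {x} ∧ M.Acceptable x) ∨ contractsOf Y s = ∅

/-- Student `s` strictly prefers the contract `(s, c)` to `Y_s`. -/
def Market.PrefersTo {S C : Type*} [DecidableEq S] (M : Market S C) (s : S) (c : C)
    (Y : Finset (S × C)) : Prop :=
  (∃ c', contractsOf Y s = {(s, c')} ∧ M.prefS s (some c) (some c')) ∨
  (contractsOf Y s = ∅ ∧ M.Acceptable (s, c))

/-- In `Y`, student `s` strongly claims an empty seat of college `c`. -/
def Market.StronglyClaims {S C : Type*} [DecidableEq S] [DecidableEq C] (M : Market S C)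
    (Y : Finset (S × C)) (s : S) (c : C) : Prop :=
  (s, c) ∈ M.X ∧ M.Acceptable (s, c) ∧ M.PrefersTo s c Y ∧ Feasible M.f (Y ∪ {(s, c)})

/-- No student strongly claims an empty seat. -/
def Market.WeaklyNonwasteful {S C : Type*} [DecidableEq S] [DecidableEq C] (M : Market S C)
    (Y : Finset (S × C)) : Prop :=
  ∀ s c, ¬ M.StronglyClaims Y s c

/-- `w` is an admissible weight function: the weights of the contracts are strictly positive and
pairwise distinct, and they respect the colleges' preferences. -/
def Market.IsWeight {S C : Type*} (M : Market S C) (w : S × C → ℝ) : Prop :=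
  (∀ x ∈ M.X, 0 < w x) ∧ Set.InjOn w (M.X : Set (S × C)) ∧
  ∀ s s' c, (s, c) ∈ M.X → (s', c) ∈ M.X → M.prefC c (some s) (some s') → w (s', c) < w (s, c)

/-- The students' choice function: of each student, the most preferred acceptable contract in `Y`
(if there is one). -/
noncomputable def Market.chS {S C : Type*} (M : Market S C) (Y : Finset (S × C)) :
    Finset (S × C) :=
  @Finset.filter (S × C) (fun x => M.Acceptable x ∧
    ∀ c', (x.1, c') ∈ Y → M.Acceptable (x.1, c') → c' ≠ x.2 → M.prefS x.1 (some x.2) (some c'))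
    (Classical.decPred _) Y

theorem Market.chS_subset {S C : Type*} (M : Market S C) (Y : Finset (S × C)) : M.chS Y ⊆ Y :=
  @Finset.filter_subset _ _ (Classical.decPred _) Y

/-- The colleges' choice function for the constraints `g` and weights `w`: the subset `Z` of `Y` that
maximizes `g(ν(Z)) + w(Z)`. (There is exactly one, if `g` induces a hereditary M-natural-convex set
and the weights on `Y` are positive and distinct.) -/
noncomputable def chC {S C : Type*} [DecidableEq C] (g : (C → ℕ) → EReal)
    (w : S × C → ℝ) (Y : Finset (S × C)) : Finset (S × C) :=
  (Finset.exists_max_image Y.powerset (fun Z => g (vec Z) + ((∑ x ∈ Z, w x : ℝ) : EReal))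
    ⟨∅, Finset.empty_mem_powerset Y⟩).choose

/-- The iteration of Generalized Deferred Acceptance on the contracts `X`, started when the contracts
in `Re` have been rejected. Students offer `chS (X \ Re)`; if colleges accept all the offers these are
the result, and otherwise the offers that are not chosen are rejected. -/
def gdaFrom {S C : Type*} [DecidableEq S] [DecidableEq C]
    (chS chC : Finset (S × C) → Finset (S × C)) (hS : ∀ Y, chS Y ⊆ Y)
    (X Re : Finset (S × C)) : Finset (S × C) :=
  if chS (X \ Re) \ chC (chS (X \ Re)) = ∅ then chS (X \ Re)
  else gdaFrom chS chC hS X (Re ∪ (chS (X \ Re) \ chC (chS (X \ Re))))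
termination_by (X \ Re).card
decreasing_by
  rename_i h
  obtain ⟨x, hx⟩ := Finset.nonempty_iff_ne_empty.mpr h
  have hxX : x ∈ X \ Re := hS _ (Finset.mem_sdiff.mp hx).1
  apply Finset.card_lt_card
  refine (Finset.ssubset_iff_of_subset ?_).mpr ⟨x, hxX, ?_⟩
  · exact Finset.sdiff_subset_sdiff (Finset.Subset.refl X) Finset.subset_union_left
  · exact fun hmem => (Finset.mem_sdiff.mp hmem).2 (Finset.mem_union_right _ hx)

/-- The result of Generalized Deferred Acceptance (GDA) on the contracts `X`. -/
def gda {S C : Type*} [DecidableEq S] [DecidableEq C]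
    (chS chC : Finset (S × C) → Finset (S × C)) (hS : ∀ Y, chS Y ⊆ Y)
    (X : Finset (S × C)) : Finset (S × C) :=
  gdaFrom chS chC hS X ∅

/-- The constraints `ν ↦ f(ν + ν(Y))` left when the contracts in `Y` are fixed. For `Y = ∅` this is
`f` itself. -/
def residual {S C : Type*} [DecidableEq C] (f : (C → ℕ) → EReal) (Y : Finset (S × C)) :
    (C → ℕ) → EReal :=
  fun ν => f (ν + vec Y)

/-- The constraints `f^d`: those of `f`, on vectors of size at most `d`. -/
noncomputable def truncate {C : Type*} [Fintype C] (f : (C → ℕ) → EReal) (d : ℕ) :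
    (C → ℕ) → EReal :=
  fun ν => if ∑ c, ν c ≤ d then f ν else ⊥

/-- The result of one stage of MS-GDA: GDA under the constraints `g` for the students in `L` and their
contracts. -/
noncomputable def Market.stageGDA {S C : Type*} [DecidableEq S] [DecidableEq C] (M : Market S C)
    (w : S × C → ℝ) (g : (C → ℕ) → EReal) (L : List S) : Finset (S × C) :=
  gda M.chS (chC g w) M.chS_subset (M.X.filter (fun x => x.1 ∈ L))

/-- `M.Run w L Y Y'`: from the state in which `L` is the remaining master list and `Y` the set of
contracts fixed so far, MS-GDA can return `Y'`. In each stage `d` is any positive integer for which the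
truncated residual constraints induce an M-natural-convex set; the top `d` students (all the students,
if fewer than `d` remain) are assigned by GDA under these constraints. -/
inductive Market.Run {S C : Type*} [DecidableEq S] [DecidableEq C] [Fintype C] (M : Market S C)
    (w : S × C → ℝ) : List S → Finset (S × C) → Finset (S × C) → Prop
  | done (Y : Finset (S × C)) : Market.Run M w [] Y Y
  | stage (L : List S) (Y Y' : Finset (S × C)) (d : ℕ) (hL : L ≠ []) (hd : 0 < d)
      (hconv : MNaturalConvex (induced (truncate (residual M.f Y) d)))
      (hnext : Market.Run M w (L.drop d)
        (Y ∪ M.stageGDA w (truncate (residual M.f Y) d) (L.take d)) Y') :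
      Market.Run M w L Y Y'

/-- MS-GDA with master list `L` and weights `w` can return `Y`, for some choice of the numbers `d`. -/
def Market.MSGDAReturns {S C : Type*} [DecidableEq S] [DecidableEq C] [Fintype C] (M : Market S C)
    (w : S × C → ℝ) (L : List S) (Y : Finset (S × C)) : Prop :=
  M.Run w L ∅ Y

end DistMatching

/-! Inside a stage, once GDA has rejected contracts it keeps a witness: the latest college choice
`A`, contained in the current offers, such that no rejected contract fits on top of `A`. The witness
passes to the next choice because all maximal members of an M-natural-convex hereditary set below a
given vector block the same coordinates (`MNaturalConvex.add_single_notMem`), and the students'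
offers retain everything that was accepted. A rejection might be due only to the size bound `d`. But
a stage has at most `d` students, so at most `d` offers, and a choice that rejects something has
fewer than `d` contracts. One more contract thus stays within the bound, and the violated constraint
is that of `f` itself. By heredity it stays violated in the result of the stage and after all later
stages. Each student holds her best unrejected contract, so she has no strong claim. The mechanism
never gets stuck, since `d = 1` is always admissible. -/

namespace DistMatching

/-! ### Hereditary and M-natural-convex sets of vectors. -/

section Vectors

variable {C : Type*} [DecidableEq C]

omit [DecidableEq C] in
theorem Hereditary.mono {F : Set (C → ℕ)} (hF : Hereditary F) {ν ν' : C → ℕ} (h : ν' ≤ ν)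
    (hν : ν ∈ F) : ν' ∈ F := by
  rcases eq_or_lt_of_le h with rfl | h
  · exact hν
  · exact hF.2 ν ν' h hν

theorem le_add_single {u v : C → ℕ} (h : u ≤ v) {i : C} (hi : u i < v i) :
    u + Pi.single i 1 ≤ v := by
  intro k
  rcases eq_or_ne k i with rfl | hk
  · simpa using hi
  · simpa [hk] using h k

variable [Fintype C]

theorem sum_add_single (u : C → ℕ) (i : C) :
    ∑ c, (u + Pi.single i 1 : C → ℕ) c = ∑ c, u c + 1 := by
  simp [Finset.sum_add_distrib]

/-- The augmentation property of M-natural-convex sets. -/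
theorem MNaturalConvex.exists_augment {F : Set (C → ℕ)} (hF : MNaturalConvex F) {u : C → ℕ}
    (hu : u ∈ F) {v : C → ℕ} (hv : v ∈ F) (huv : ∑ c, u c < ∑ c, v c) :
    ∃ i, u i < v i ∧ u + Pi.single i 1 ∈ F := by
  induction hn : ∑ c, (v c - u c) using Nat.strong_induction_on generalizing v with
  | _ n ih =>
    obtain ⟨i, -, hi⟩ := Finset.exists_lt_of_sum_lt huv
    -- The second alternative replaces `v` by a vector of the same sum whose excess over `u` is
    -- smaller: it drops by one at `i`, and at `j` there was room below `u`.
    rcases hF v hv u hu i hi with h | ⟨j, hj, h, -⟩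
    · exact ⟨i, hi, h.2⟩
    · have hij : j ≠ i := by rintro rfl; omega
      have key : ∀ k, u k < (v - Pi.single i 1 + Pi.single j 1 : C → ℕ) k → u k < v k := by
        intro k hk
        rcases eq_or_ne k j with rfl | hkj
        · simp [hij] at hk; omega
        · simp [hkj] at hk; omega
      have hsum : ∑ c, (v - Pi.single i 1 + Pi.single j 1 : C → ℕ) c = ∑ c, v c := by
        have h1 : (v - Pi.single i 1 + Pi.single i 1 : C → ℕ) = v := by
          funext k
          rcases eq_or_ne k i with rfl | hk
          · simp; omega
          · simp [hk]
        rw [sum_add_single, ← sum_add_single _ i, h1]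
      have hlt : ∑ c, ((v - Pi.single i 1 + Pi.single j 1 : C → ℕ) c - u c) < n := by
        rw [← hn]
        apply Finset.sum_lt_sum
        · intro k _
          rcases eq_or_ne k j with rfl | hkj
          · simp [hij]; omega
          · simp [hkj]; omega
        · refine ⟨i, Finset.mem_univ _, ?_⟩
          simp [hij.symm]; omega
      obtain ⟨k, hk, hkF⟩ := ih _ hlt h (by rw [hsum]; exact huv) rfl
      exact ⟨k, key k hk, hkF⟩

/-- If `z` is a maximal member of `F` below `y`, then it blocks every coordinate that is blocked by
some member of `F` below `y`. -/
theorem MNaturalConvex.add_single_notMem {F : Set (C → ℕ)} (hF : MNaturalConvex F)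
    (hH : Hereditary F) {u y z : C → ℕ} (hu : u ∈ F) (huy : u ≤ y) (hz : z ∈ F)
    (hzy : z ≤ y) (hmax : ∀ i, z i < y i → z + Pi.single i 1 ∉ F) {c : C}
    (hc : u + Pi.single c 1 ∉ F) : z + Pi.single c 1 ∉ F := by
  intro hzc
  -- Enlarge `u` to a maximal member `b` of `F` below `y`. As `z` cannot be augmented within `y`,
  -- `b` is no larger in sum than `z`, so `z + e_c ∈ F` would augment `b`: at `c` against the
  -- blocking by `u`, elsewhere against maximality.
  obtain ⟨b, hub, hb⟩ :=
    ((Set.finite_Iic y).subset (Set.inter_subset_right (s := F))).exists_le_maximal ⟨hu, huy⟩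
  have hbmax : ∀ i, b i < y i → b + Pi.single i 1 ∉ F := by
    intro i hi hbi
    have := hb.2 (y := b + Pi.single i 1) ⟨hbi, le_add_single hb.1.2 hi⟩ (by simp) i
    simp at this
  have h1 : ∑ c, b c ≤ ∑ c, z c := by
    by_contra! h
    obtain ⟨i, hi, hiF⟩ := hF.exists_augment hz hb.1.1 h
    exact hmax i (hi.trans_le (hb.1.2 i)) hiF
  obtain ⟨i, hi, hiF⟩ := hF.exists_augment hb.1.1 hzc (by rw [sum_add_single]; omega)
  rcases eq_or_ne i c with rfl | hic
  · exact hc (hH.mono (by gcongr) hiF)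
  · simp [hic] at hi
    exact hbmax i (hi.trans_le (hzy i)) hiF

omit [DecidableEq C] in
theorem mem_induced_truncate {f : (C → ℕ) → EReal} {d : ℕ} {ν : C → ℕ} :
    ν ∈ induced (truncate f d) ↔ ∑ c, ν c ≤ d ∧ ν ∈ induced f := by
  by_cases h : ∑ c, ν c ≤ d <;> simp [induced, truncate, h]

omit [DecidableEq C] in
theorem Hereditary.truncate {f : (C → ℕ) → EReal} (hf : Hereditary (induced f)) (d : ℕ) :
    Hereditary (induced (truncate f d)) := by
  refine ⟨mem_induced_truncate.2 ⟨by simp, hf.1⟩, fun ν ν' h hν => ?_⟩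
  rw [mem_induced_truncate] at hν ⊢
  exact ⟨(Finset.sum_le_sum fun c _ => h.le c).trans hν.1, hf.2 ν ν' h hν.2⟩

/-- Vectors of size at most `1` always form an M-natural-convex set. -/
theorem mNaturalConvex_truncate_one (f : (C → ℕ) → EReal) :
    MNaturalConvex (induced (truncate f 1)) := by
  have hsingle : ∀ ν ∈ induced (truncate f 1), ∀ i, 0 < ν i →
      ν = Pi.single i 1 := by
    intro ν hν i hi
    have h := (mem_induced_truncate.1 hν).1
    rw [← Finset.add_sum_erase _ _ (Finset.mem_univ i)] at h
    have h0 : ∑ c ∈ Finset.univ.erase i, ν c = 0 := by omega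
    funext k
    rcases eq_or_ne k i with rfl | hk
    · simp; omega
    · have := Finset.sum_eq_zero_iff.1 h0 k (by simp [hk])
      simpa [hk] using this
  -- Nonzero members are unit vectors, so each exchange merely swaps `ν` and `ν'`.
  intro ν hν ν' hν' i hi
  have hνi := hsingle ν hν i (by omega)
  by_cases h0 : ν' = 0
  · subst h0
    left
    rw [hνi] at hν ⊢
    exact ⟨by simpa using hν', by simpa using hν⟩
  · obtain ⟨j, hj⟩ := Function.ne_iff.1 h0
    have hj' : 0 < ν' j := Nat.pos_of_ne_zero hj
    have hνj := hsingle ν' hν' j hj'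
    right
    have hij : j ≠ i := by
      rintro rfl
      rw [hνi, hνj] at hi; simp at hi
    refine ⟨j, by rw [hνi, hνj]; simp [hij], ?_, ?_⟩
    · rw [hνi, ← hνj]; simpa using hν'
    · rw [hνj, ← hνi]; simpa using hν

end Vectors

/-! ### Choice functions of colleges and students. -/

section Choice

variable {S C : Type*} [DecidableEq S] [DecidableEq C]

omit [DecidableEq S] in
theorem vec_empty : vec (∅ : Finset (S × C)) = 0 := by
  funext c; simp [vec]

omit [DecidableEq S] in
theorem vec_mono {A B : Finset (S × C)} (h : A ⊆ B) : vec A ≤ vec B := fun _ =>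
  Finset.card_le_card (Finset.filter_subset_filter _ h)

theorem vec_union {A B : Finset (S × C)} (h : Disjoint A B) : vec (A ∪ B) = vec A + vec B := by
  funext c
  simp only [vec, Pi.add_apply, Finset.filter_union]
  exact Finset.card_union_of_disjoint (Finset.disjoint_filter_filter h)

omit [DecidableEq S] in
theorem vec_singleton (x : S × C) : vec {x} = Pi.single x.2 1 := by
  funext c
  rcases eq_or_ne c x.2 with rfl | h
  · simp [vec, Finset.filter_singleton]
  · simp [vec, Finset.filter_singleton, h, h.symm]

omit [DecidableEq S] in
theorem sum_vec [Fintype C] (A : Finset (S × C)) : ∑ c, vec A c = A.card :=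
  (Finset.card_eq_sum_card_fiberwise fun _ _ => Finset.mem_univ _).symm

omit [DecidableEq S] in
theorem residual_hereditary {f : (C → ℕ) → EReal} (hf : Hereditary (induced f))
    {Y : Finset (S × C)} (hY : Feasible f Y) : Hereditary (induced (residual f Y)) := by
  refine ⟨by simpa [induced, residual, Feasible] using hY, fun ν ν' h hν => ?_⟩
  exact hf.mono (ν := ν + vec Y) (add_le_add_left h.le _) hν

omit [DecidableEq S] in
theorem chC_subset (g : (C → ℕ) → EReal) (w : S × C → ℝ) (Y : Finset (S × C)) :
    chC g w Y ⊆ Y := by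
  rw [← Finset.mem_powerset]
  exact (Finset.exists_max_image Y.powerset
    (fun Z => g (vec Z) + ((∑ x ∈ Z, w x : ℝ) : EReal)) ⟨∅, Finset.empty_mem_powerset Y⟩).choose_spec.1

omit [DecidableEq S] in
theorem le_chC (g : (C → ℕ) → EReal) (w : S × C → ℝ) {Y Z : Finset (S × C)} (hZ : Z ⊆ Y) :
    g (vec Z) + ((∑ x ∈ Z, w x : ℝ) : EReal) ≤
      g (vec (chC g w Y)) + ((∑ x ∈ chC g w Y, w x : ℝ) : EReal) :=
  (Finset.exists_max_image Y.powerset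
    (fun Z => g (vec Z) + ((∑ x ∈ Z, w x : ℝ) : EReal))
    ⟨∅, Finset.empty_mem_powerset Y⟩).choose_spec.2 Z (Finset.mem_powerset.2 hZ)

-- The empty set has value `0`, whereas `⊥` plus a real weight is `⊥`, so an infeasible set cannot
-- be optimal.
omit [DecidableEq S] in
theorem vec_chC_mem {g : (C → ℕ) → EReal} (hg : ∀ ν, g ν = ⊥ ∨ g ν = 0)
    (h0 : 0 ∈ induced g) (w : S × C → ℝ) (Y : Finset (S × C)) :
    vec (chC g w Y) ∈ induced g := by
  rcases hg (vec (chC g w Y)) with h | h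
  · have := le_chC g w (Finset.empty_subset Y)
    have h0' : g 0 = 0 := h0
    simp [h, vec_empty, h0'] at this
  · exact h

/-- Otherwise an unchosen contract of `c` could be added, and its positive weight would beat the
optimum. -/
theorem chC_maximal {g : (C → ℕ) → EReal} (hg : ∀ ν, g ν = ⊥ ∨ g ν = 0)
    (h0 : 0 ∈ induced g) {w : S × C → ℝ} {Y : Finset (S × C)} (hw : ∀ x ∈ Y, 0 < w x) (c : C)
    (hc : vec (chC g w Y) c < vec Y c) : vec (chC g w Y) + Pi.single c 1 ∉ induced g := by
  intro hmem
  obtain ⟨x, hx, hxn⟩ := Finset.exists_mem_notMem_of_card_lt_card hc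
  obtain ⟨hxY, rfl⟩ := Finset.mem_filter.1 hx
  have hxZ : x ∉ chC g w Y := fun h => hxn (Finset.mem_filter.2 ⟨h, rfl⟩)
  have hle := le_chC g w (Finset.union_subset (chC_subset g w Y) (Finset.singleton_subset_iff.2 hxY))
  have hdis : Disjoint (chC g w Y) {x} := Finset.disjoint_singleton_right.2 hxZ
  have hmem' : g (vec (chC g w Y) + Pi.single x.2 1) = 0 := hmem
  have hZ : g (vec (chC g w Y)) = 0 := vec_chC_mem hg h0 w Y
  rw [vec_union hdis, vec_singleton, hmem', hZ, zero_add, zero_add, EReal.coe_le_coe_iff,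
    Finset.sum_union hdis, Finset.sum_singleton] at hle
  linarith [hw x hxY]

variable (M : Market S C)

omit [DecidableEq S] [DecidableEq C] in
theorem Market.mem_chS {Y : Finset (S × C)} {x : S × C} :
    x ∈ M.chS Y ↔ x ∈ Y ∧ M.Acceptable x ∧ ∀ c', (x.1, c') ∈ Y → M.Acceptable (x.1, c') →
      c' ≠ x.2 → M.prefS x.1 (some x.2) (some c') := by
  simp [Market.chS]

omit [DecidableEq S] [DecidableEq C] in
theorem Market.some_mem {s : S} {c : C} (h : (s, c) ∈ M.X) :
    (some c : Option C) ∈ {o : Option C | ∀ c, o = some c → (s, c) ∈ M.X} := by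
  intro c' hc'
  cases hc'
  exact h

omit [DecidableEq S] [DecidableEq C] in
theorem Market.prefS_asymm {s : S} {c c' : C} (h : (s, c) ∈ M.X) (h' : (s, c') ∈ M.X)
    (hcc : M.prefS s (some c) (some c')) : ¬ M.prefS s (some c') (some c) := fun hcc' =>
  (M.prefS_strict s).1 _ (M.some_mem h) ((M.prefS_strict s).2.1 _ (M.some_mem h) _ (M.some_mem h')
    _ (M.some_mem h) hcc hcc')

omit [DecidableEq S] [DecidableEq C] in
theorem Market.chS_unique {Y : Finset (S × C)} (hY : Y ⊆ M.X) {s : S} {c c' : C}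
    (h : (s, c) ∈ M.chS Y) (h' : (s, c') ∈ M.chS Y) : c = c' := by
  by_contra hne
  have h1 := M.mem_chS.1 h
  have h2 := M.mem_chS.1 h'
  exact M.prefS_asymm (hY h1.1) (hY h2.1) (h1.2.2 c' h2.1 h2.2.1 (Ne.symm hne))
    (h2.2.2 c h1.1 h1.2.1 hne)

omit [DecidableEq C] in
/-- A student with an acceptable contract has a most preferred one. -/
theorem Market.exists_mem_chS {Y : Finset (S × C)} (hY : Y ⊆ M.X) {s : S} {c : C}
    (h : (s, c) ∈ Y) (ha : M.Acceptable (s, c)) : ∃ c', (s, c') ∈ M.chS Y := by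
  classical
  let T : Finset (S × C) := Y.filter fun x => x.1 = s ∧ M.Acceptable x
  -- Preferences are ordered only on available contracts; confining the relation to `T` makes it a
  -- strict order on the whole type, well-founded on the finite set `T`.
  let r : S × C → S × C → Prop := fun x y =>
    x ∈ T ∧ y ∈ T ∧ M.prefS s (some x.2) (some y.2)
  have hT : ∀ x ∈ T, (s, x.2) ∈ M.X := by
    rintro ⟨a, b⟩ hx
    obtain ⟨h1, rfl, -⟩ := Finset.mem_filter.1 hx
    exact hY h1
  have : IsStrictOrder (S × C) r :=
    { irrefl := fun x hx => (M.prefS_strict s).1 _ (M.some_mem (hT x hx.1)) hx.2.2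
      trans := fun x y z hxy hyz => ⟨hxy.1, hyz.2.1, (M.prefS_strict s).2.1 _
        (M.some_mem (hT x hxy.1)) _ (M.some_mem (hT y hxy.2.1)) _ (M.some_mem (hT z hyz.2.1))
        hxy.2.2 hyz.2.2⟩ }
  obtain ⟨⟨⟨a, b⟩, hx⟩, -, hmin⟩ := (T.finite_toSet.wellFoundedOn (r := r)).has_min Set.univ
    ⟨⟨(s, c), Finset.mem_filter.2 ⟨h, rfl, ha⟩⟩, trivial⟩
  obtain ⟨hab, rfl, haccept⟩ := Finset.mem_filter.1 hx
  refine ⟨b, M.mem_chS.2 ⟨hab, haccept, fun c' hc' hac' hne => ?_⟩⟩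
  have hc'T : (a, c') ∈ T := Finset.mem_filter.2 ⟨hc', rfl, hac'⟩
  rcases (M.prefS_strict a).2.2 _ (M.some_mem (hY hab)) _ (M.some_mem (hY hc')) with h1 | h1 | h1
  · exact h1
  · exact absurd (Option.some.inj h1).symm hne
  · exact absurd ⟨hc'T, hx, h1⟩ (hmin ⟨(a, c'), hc'T⟩ trivial)

-- Substitutability: an accepted offer is repeated after other contracts have been rejected.
omit [DecidableEq S] [DecidableEq C] in
theorem Market.mem_chS_of_subset {Y Y' : Finset (S × C)} (h : Y' ⊆ Y) {x : S × C}
    (hx : x ∈ M.chS Y) (hx' : x ∈ Y') : x ∈ M.chS Y' := by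
  rw [M.mem_chS] at hx ⊢
  exact ⟨hx', hx.2.1, fun c' hc' => hx.2.2 c' (h hc')⟩

omit [DecidableEq C] in
theorem Market.card_chS_le {Y : Finset (S × C)} (hY : Y ⊆ M.X) {L : List S}
    (hL : ∀ x ∈ Y, x.1 ∈ L) : (M.chS Y).card ≤ L.length := by
  refine le_trans ?_ (List.toFinset_card_le L)
  refine Finset.card_le_card_of_injOn Prod.fst
    (fun x hx => List.mem_toFinset.2 (hL x (M.chS_subset Y hx))) ?_
  rintro ⟨s, c⟩ hx ⟨s', c'⟩ hx' h
  obtain rfl : s = s' := h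
  rw [M.chS_unique hY hx hx']

end Choice

/-! ### The invariants of GDA and of the stages of MS-GDA. -/

section Mechanism

variable {S C : Type*} [DecidableEq S] [DecidableEq C] [Fintype C] (M : Market S C)

/-- The outcome of GDA is the set of best contracts that have not been rejected; it is feasible, and
it contains a set of fewer than `d` contracts to which no rejected contract can be added. -/
theorem Market.gdaFrom_spec {g : (C → ℕ) → EReal} (hg : ∀ ν, g ν = ⊥ ∨ g ν = 0)
    (hH : Hereditary (induced g)) (hconv : MNaturalConvex (induced g)) {w : S × C → ℝ}
    {X : Finset (S × C)} (hw : ∀ x ∈ X, 0 < w x) {d : ℕ}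
    (hd : ∀ Y ⊆ X, (M.chS Y).card ≤ d) (Re A : Finset (S × C))
    (hA : A ⊆ M.chS (X \ Re)) (hAg : vec A ∈ induced g)
    (hRe : ∀ x ∈ Re, A.card < d ∧ vec A + Pi.single x.2 1 ∉ induced g) :
    ∃ Re' A' : Finset (S × C), gdaFrom M.chS (chC g w) M.chS_subset X Re = M.chS (X \ Re') ∧
      vec (M.chS (X \ Re')) ∈ induced g ∧ A' ⊆ M.chS (X \ Re') ∧
      ∀ x ∈ Re', A'.card < d ∧ vec A' + Pi.single x.2 1 ∉ induced g := by
  induction hn : (X \ Re).card using Nat.strong_induction_on generalizing Re A with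
  | _ n ih =>
    set Y := M.chS (X \ Re) with hYdef
    have hYX : Y ⊆ X := (M.chS_subset _).trans Finset.sdiff_subset
    have hZY : chC g w Y ⊆ Y := chC_subset g w Y
    have hZg : vec (chC g w Y) ∈ induced g := vec_chC_mem hg hH.1 w Y
    rw [gdaFrom]
    split_ifs with h
    · refine ⟨Re, A, rfl, ?_, hA, hRe⟩
      rwa [← hYdef, ← hZY.antisymm (Finset.sdiff_eq_empty_iff_subset.1 h)]
    · obtain ⟨x, hx⟩ := Finset.nonempty_iff_ne_empty.2 h
      have hxX : x ∈ X \ Re := M.chS_subset _ (Finset.sdiff_subset hx)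
      have hsub : X \ (Re ∪ (Y \ chC g w Y)) ⊆ X \ Re :=
        Finset.sdiff_subset_sdiff subset_rfl Finset.subset_union_left
      have hmax := chC_maximal hg hH.1 (fun x hx => hw x (hYX hx)) (w := w) (Y := Y)
      -- The new witness is the choice `chC g w Y`, not the final outcome: the latter may have `d`
      -- contracts, and then the truncation alone would block every addition.
      refine ih _ ?_ (Re ∪ (Y \ chC g w Y)) (chC g w Y) ?_ hZg ?_ rfl
      · rw [← hn]
        refine Finset.card_lt_card ((Finset.ssubset_iff_of_subset hsub).2 ⟨x, hxX, fun hmem => ?_⟩)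
        exact (Finset.mem_sdiff.1 hmem).2 (Finset.mem_union_right _ hx)
      · intro y hy
        refine M.mem_chS_of_subset hsub (hZY hy) (Finset.mem_sdiff.2 ⟨hYX (hZY hy), fun hmem => ?_⟩)
        rcases Finset.mem_union.1 hmem with hyRe | hyZ
        · exact (Finset.mem_sdiff.1 (M.chS_subset _ (hZY hy))).2 hyRe
        · exact (Finset.mem_sdiff.1 hyZ).2 hy
      · intro y hy
        refine ⟨(Finset.card_lt_card ((Finset.ssubset_iff_of_subset hZY).2
          ⟨x, Finset.mem_sdiff.1 hx⟩)).trans_le (hd _ Finset.sdiff_subset), ?_⟩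
        rcases Finset.mem_union.1 hy with hyRe | hyZ
        -- Earlier rejections: the old witness and the new choice both lie below the current offers,
        -- and the new choice is maximal there.
        · exact hconv.add_single_notMem hH hAg (vec_mono hA) hZg (vec_mono hZY) hmax (hRe y hyRe).2
        · obtain ⟨hyY, hyZ⟩ := Finset.mem_sdiff.1 hyZ
          refine hmax _ (Finset.card_lt_card ?_)
          refine (Finset.ssubset_iff_of_subset (Finset.filter_subset_filter _ hZY)).2
            ⟨y, Finset.mem_filter.2 ⟨hyY, rfl⟩, fun hmem => hyZ (Finset.mem_filter.1 hmem).1⟩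

/-- A stage of MS-GDA chooses, for its students, a feasible set of best contracts outside a set of
contracts that cannot be added to the result. -/
theorem Market.stageGDA_spec {f : (C → ℕ) → EReal} (hf : ∀ ν, f ν = ⊥ ∨ f ν = 0)
    (hH : Hereditary (induced f)) {d : ℕ}
    (hconv : MNaturalConvex (induced (truncate f d))) {w : S × C → ℝ} (hw : ∀ x ∈ M.X, 0 < w x)
    {L : List S} (hL : L.length ≤ d) :
    ∃ Re : Finset (S × C), M.stageGDA w (truncate f d) L =
        M.chS (M.X.filter (fun x => x.1 ∈ L) \ Re) ∧
      vec (M.stageGDA w (truncate f d) L) ∈ induced f ∧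
      ∀ x ∈ Re, vec (M.stageGDA w (truncate f d) L) + Pi.single x.2 1 ∉ induced f := by
  have hg : ∀ ν, truncate f d ν = ⊥ ∨ truncate f d ν = 0 := by
    intro ν
    unfold truncate
    split_ifs
    · exact hf ν
    · exact Or.inl rfl
  have hd : ∀ Y ⊆ M.X.filter (fun x => x.1 ∈ L), (M.chS Y).card ≤ d := fun Y hY =>
    (M.card_chS_le (hY.trans (Finset.filter_subset _ _))
      (fun x hx => (Finset.mem_filter.1 (hY hx)).2)).trans hL
  obtain ⟨Re, A, heq, hfeas, hA, hRe⟩ := M.gdaFrom_spec hg (hH.truncate d) hconv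
    (fun x hx => hw x (Finset.mem_filter.1 hx).1) hd ∅ ∅
    (Finset.empty_subset _) (by rw [vec_empty]; exact (hH.truncate d).1) (by simp)
  refine ⟨Re, heq, ?_, fun x hx hmem => ?_⟩
  · rw [Market.stageGDA, gda, heq]
    exact (mem_induced_truncate.1 hfeas).2
  · rw [Market.stageGDA, gda, heq] at hmem
    obtain ⟨hcard, hnot⟩ := hRe x hx
    -- `A.card < d` keeps the enlarged vector within the size bound, so the infeasibility comes from
    -- `f`.
    refine hnot (mem_induced_truncate.2 ⟨?_, hH.mono ?_ hmem⟩)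
    · rw [sum_add_single, sum_vec]; exact hcard
    · exact add_le_add_left (vec_mono hA) _

/-- The properties of a state of MS-GDA: the remaining students `L` have no contracts yet, and no
other student strongly claims an empty seat. -/
structure Market.IsState (L : List S) (Y : Finset (S × C)) : Prop where
  matching : M.IsMatching Y
  feasible : Feasible M.f Y
  unassigned : ∀ x ∈ Y, x.1 ∉ L
  noClaims : ∀ s ∉ L, ∀ c, ¬ M.StronglyClaims Y s c

omit [Fintype C] in
theorem contractsOf_union (A B : Finset (S × C)) (s : S) :
    contractsOf (A ∪ B) s = contractsOf A s ∪ contractsOf B s :=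
  Finset.filter_union _ _ _

omit [DecidableEq C] [Fintype C] in
theorem contractsOf_eq_empty {A : Finset (S × C)} {s : S} (h : ∀ x ∈ A, x.1 ≠ s) :
    contractsOf A s = ∅ :=
  Finset.filter_eq_empty_iff.2 h

omit [DecidableEq C] [Fintype C] in
theorem Market.contractsOf_chS {Y : Finset (S × C)} (hY : Y ⊆ M.X) {s : S} {c : C}
    (h : (s, c) ∈ M.chS Y) : contractsOf (M.chS Y) s = {(s, c)} := by
  ext ⟨s', c'⟩
  simp only [contractsOf, Finset.mem_filter, Finset.mem_singleton]
  constructor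
  · rintro ⟨h', rfl⟩
    rw [M.chS_unique hY h h']
  · rintro h'
    cases h'
    exact ⟨h, rfl⟩

omit [DecidableEq C] [Fintype C] in
theorem Market.chS_isMatching {Y : Finset (S × C)} (hY : Y ⊆ M.X) : M.IsMatching (M.chS Y) := by
  refine ⟨(M.chS_subset Y).trans hY, fun s => ?_⟩
  rcases Finset.eq_empty_or_nonempty (contractsOf (M.chS Y) s) with h | ⟨⟨s', c⟩, h⟩
  · exact Or.inr h
  · obtain ⟨hx, rfl⟩ := Finset.mem_filter.1 h
    exact Or.inl ⟨_, M.contractsOf_chS hY hx, (M.mem_chS.1 hx).2.1⟩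

omit [DecidableEq C] [Fintype C] in
/-- A student does not prefer any acceptable available contract to her chosen one. -/
theorem Market.not_prefersTo_chS {Y : Finset (S × C)} (hY : Y ⊆ M.X) {s : S} {c : C}
    (h : (s, c) ∈ Y) (ha : M.Acceptable (s, c)) : ¬ M.PrefersTo s c (M.chS Y) := by
  obtain ⟨c₀, hc₀⟩ := M.exists_mem_chS hY h ha
  have h₀ := M.mem_chS.1 hc₀
  rintro (⟨c', hc', hpref⟩ | ⟨he, -⟩)
  · rw [M.contractsOf_chS hY hc₀, Finset.singleton_inj] at hc'
    cases hc'
    rcases eq_or_ne c c₀ with rfl | hne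
    · exact M.prefS_asymm (hY h) (hY h) hpref hpref
    · exact M.prefS_asymm (hY h) (hY h₀.1) hpref (h₀.2.2 c h ha hne)
  · rw [M.contractsOf_chS hY hc₀] at he
    exact Finset.singleton_ne_empty _ he

variable {M}

/-- A claim by a student of this stage must concern a rejected contract, which the residual
constraints exclude; a claim by an earlier student would, by heredity, already have existed in `Y`.
-/
theorem Market.IsState.stage (hf : Hereditary (induced M.f)) {w : S × C → ℝ} (hw : M.IsWeight w)
    {L : List S} (hnodup : L.Nodup) {Y : Finset (S × C)} (hY : M.IsState L Y) {d : ℕ}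
    (hconv : MNaturalConvex (induced (truncate (residual M.f Y) d))) :
    M.IsState (L.drop d) (Y ∪ M.stageGDA w (truncate (residual M.f Y) d) (L.take d)) := by
  obtain ⟨Re, heq, hfeas, hRe⟩ := M.stageGDA_spec (f := residual M.f Y) (fun ν => M.f_range _)
    (residual_hereditary hf hY.feasible) hconv hw.1 (List.length_take_le d L)
  set Z := M.stageGDA w (truncate (residual M.f Y) d) (L.take d)
  set X' := M.X.filter (fun x => x.1 ∈ L.take d) \ Re
  have hX'X : X' ⊆ M.X := Finset.sdiff_subset.trans (Finset.filter_subset _ _)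
  have hZL : ∀ x ∈ Z, x.1 ∈ L.take d := fun x hx => by
    rw [heq] at hx
    exact (Finset.mem_filter.1 (Finset.sdiff_subset (M.chS_subset _ hx))).2
  have hYZ : ∀ s ∈ L, contractsOf Y s = ∅ := fun s hs =>
    contractsOf_eq_empty fun x hx h => hY.unassigned x hx (h ▸ hs)
  have hZY : ∀ s, s ∉ L → contractsOf Z s = ∅ := fun s hs =>
    contractsOf_eq_empty fun x hx h => hs (h ▸ List.mem_of_mem_take (hZL x hx))
  have hdisj : Disjoint Y Z := Finset.disjoint_left.2 fun x hxY hxZ =>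
    hY.unassigned x hxY (List.mem_of_mem_take (hZL x hxZ))
  have hZm : M.IsMatching Z := heq ▸ M.chS_isMatching hX'X
  refine ⟨⟨Finset.union_subset hY.matching.1 hZm.1, fun s => ?_⟩, ?_, ?_, ?_⟩
  · rw [contractsOf_union]
    by_cases hs : s ∈ L
    · rw [hYZ s hs, Finset.empty_union]
      exact hZm.2 s
    · rw [hZY s hs, Finset.union_empty]
      exact hY.matching.2 s
  · rw [Feasible, vec_union hdisj, add_comm]
    exact hfeas
  · intro x hx hdrop
    rcases Finset.mem_union.1 hx with hx | hx
    · exact hY.unassigned x hx (List.mem_of_mem_drop hdrop)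
    · exact List.disjoint_take_drop hnodup le_rfl (hZL x hx) hdrop
  · rintro s hs c ⟨hX, ha, hpref, hfeas'⟩
    by_cases hsL : s ∈ L
    · have hst : s ∈ L.take d := by
        rw [← List.take_append_drop d L, List.mem_append] at hsL
        exact hsL.resolve_right hs
      have hprefZ : M.PrefersTo s c Z := by
        simpa only [Market.PrefersTo, contractsOf_union, hYZ s hsL, Finset.empty_union] using hpref
      have hscRe : (s, c) ∈ Re := by
        by_contra hn
        rw [heq] at hprefZ
        exact M.not_prefersTo_chS hX'X
          (Finset.mem_sdiff.2 ⟨Finset.mem_filter.2 ⟨hX, hst⟩, hn⟩) ha hprefZ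
      have hnotZ : (s, c) ∉ Z := by
        rw [heq]
        exact fun h => (Finset.mem_sdiff.1 (M.chS_subset _ h)).2 hscRe
      have hnotY : (s, c) ∉ Y := fun h => hY.unassigned _ h hsL
      apply hRe _ hscRe
      rw [Feasible, vec_union (by simp [hnotY, hnotZ]), vec_union hdisj, vec_singleton] at hfeas'
      change M.f _ = 0
      rwa [add_right_comm, add_comm (vec Z)]
    · refine hY.noClaims s hsL c ⟨hX, ha, ?_, ?_⟩
      · simpa only [Market.PrefersTo, contractsOf_union, hZY s hsL, Finset.union_empty] using hpref
      · exact hf.mono (vec_mono (Finset.union_subset_union_left Finset.subset_union_left)) hfeas'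

theorem Market.IsState.of_run (hf : Hereditary (induced M.f)) {w : S × C → ℝ} (hw : M.IsWeight w)
    {L : List S} {Y Y' : Finset (S × C)} (hrun : M.Run w L Y Y') (hnodup : L.Nodup)
    (hY : M.IsState L Y) : M.IsState [] Y' := by
  induction hrun with
  | done Y => exact hY
  | stage L Y Y' d _ _ hconv _ ih =>
    exact ih (hnodup.sublist (List.drop_sublist d L)) (hY.stage hf hw hnodup hconv)

theorem Market.IsState.exists_run (hf : Hereditary (induced M.f)) {w : S × C → ℝ}
    (hw : M.IsWeight w) {L : List S} (hnodup : L.Nodup) {Y : Finset (S × C)}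
    (hY : M.IsState L Y) : ∃ Y', M.Run w L Y Y' := by
  induction L generalizing Y with
  | nil => exact ⟨Y, .done Y⟩
  | cons s L ih =>
    have hconv := mNaturalConvex_truncate_one (residual M.f Y)
    obtain ⟨Y', hY'⟩ := ih hnodup.of_cons (hY.stage hf hw hnodup hconv)
    exact ⟨Y', .stage _ _ _ 1 (List.cons_ne_nil s L) one_pos hconv hY'⟩

end Mechanism

end DistMatching

theorem mainTheorem2 {S C : Type*} [Fintype S] [Fintype C] [DecidableEq S] [DecidableEq C]
    (M : DistMatching.Market S C)
    (hf : DistMatching.Hereditary (DistMatching.induced M.f))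
    (w : S × C → ℝ) (hw : M.IsWeight w)
    (L : List S) (hnodup : L.Nodup) (hL : ∀ s, s ∈ L) :
    (∃ Y, M.MSGDAReturns w L Y) ∧
      ∀ Y, M.MSGDAReturns w L Y → M.IsMatching Y ∧ M.WeaklyNonwasteful Y := by
  -- Initially every student is on the list, so `noClaims` is vacuous; once the list is empty it
  -- covers everyone.
  have hstart : M.IsState L ∅ :=
    { matching := ⟨Finset.empty_subset _, fun s => Or.inr rfl⟩
      feasible := by
        rw [DistMatching.Feasible, DistMatching.vec_empty]
        exact hf.1
      unassigned := by simp
      noClaims := fun s hs => absurd (hL s) hs }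
  refine ⟨hstart.exists_run hf hw hnodup, fun Y hY => ?_⟩
  have hend := DistMatching.Market.IsState.of_run hf hw hY hnodup hstart
  exact ⟨hend.matching, fun s c => hend.noClaims s List.not_mem_nil c⟩
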